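/- There is a constant $C>0$, depending only on the domain $\Omega=(-1,1)$, such that the following holds. Let $K>1$, let $f\in H^1(-1,1)$ be complex-valued with compact support contained in $(-1,1)$, and for every $\omega\in(0,K)$ let $u(\cdot,\omega)\in H^2(-1,1)$ solve $$u''(x,\omega)+\omega^2u(x,\omega)=f(x)\quad\text{for a.e. }x\in(-1,1),\qquad u'(-1,\omega)+i\omega u(-1,\omega)=0,\quad u'(1,\omega)-i\omega u(1,\omega)=0,$$ where the primes are derivatives in $x$. Define $\varepsilon\ge 0$ by $$\varepsilon^2=\int_0^K\omega^2\big(|u(1,\omega)|^2+|u(-1,\omega)|^2\big)\,d\omega,$$ and put $M=\max\{\|f\|_{H^1(-1,1)}^2,1\}$, where $\|f\|_{H^1(-1,1)}^2=\|f\|_{L^2(-1,1)}^2+\|f'\|_{L^2(-1,1)}^2$. If $\varepsilon>0$, then $$\|f\|_{L^2(-1,1)}^2\le C\Big(\varepsilon^2+\frac{M^2}{K^{2/3}E^{1/4}+1}\Big),$$ where $E=-\ln\varepsilon$ if $0<\varepsilon\le1$ and $E=0$ if $\varepsilon>1$. If $\varepsilon=0$ (that is, $E=+\infty$), then $f=0$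 almost everywhere in $(-1,1)$. -/

import Mathlib

namespace HelmholtzSource

open MeasureTheory Set
open scoped ContDiff

/-- The domain `Ω = (-1,1)`. -/
abbrev dom : Set ℝ := Ioo (-1 : ℝ) 1

/-- Lebesgue measure on `Ω = (-1,1)`. -/
noncomputable abbrev domMeasure : Measure ℝ := volume.restrict dom

/-- `g` is a weak (distributional) derivative of `f` on `(-1,1)`: both are locally integrable there
and `∫ f φ' = - ∫ g φ` for every complex-valued test function `φ ∈ C_c^∞(-1,1)`. -/
structure IsWeakDeriv (f g : ℝ → ℂ) : Prop where
  locInt_left : LocallyIntegrableOn f dom volume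
  locInt_right : LocallyIntegrableOn g dom volume
  integral_eq : ∀ φ : ℝ → ℂ, ContDiff ℝ ∞ φ → HasCompactSupport φ → tsupport φ ⊆ dom →
    ∫ x, f x * deriv φ x ∂domMeasure = - ∫ x, g x * φ x ∂domMeasure

open Classical in
/-- The weak derivative of `f` on `(-1,1)` (a representative of it; it is unique up to a null set),
and `0` if `f` has no weak derivative. -/
noncomputable def weakDeriv (f : ℝ → ℂ) : ℝ → ℂ :=
  if h : ∃ g, IsWeakDeriv f g then h.choose else 0

/-- Membership in the Sobolev space `H^l(-1,1) = W^{l,2}(-1,1)` of complex-valued functions: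
the weak derivatives of orders `0, …, l` exist and lie in `L²(-1,1)`. -/
def MemSobolev : ℕ → (ℝ → ℂ) → Prop
  | 0, f => MemLp f 2 domMeasure
  | l + 1, f => MemLp f 2 domMeasure ∧ (∃ g, IsWeakDeriv f g) ∧ MemSobolev l (weakDeriv f)

/-- The square of the standard norm of `H^l(-1,1)`: the sum of the squared `L²(-1,1)` norms of
the weak derivatives of orders `0, …, l`. For `l = 0` it is the squared `L²(-1,1)` norm. -/
noncomputable def sobolevNormSq : ℕ → (ℝ → ℂ) → ℝ
  | 0, f => ∫ x, ‖f x‖ ^ 2 ∂domMeasure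
  | l + 1, f => (∫ x, ‖f x‖ ^ 2 ∂domMeasure) + sobolevNormSq l (weakDeriv f)

/-- The support of (the a.e. class of) `f` is a compact subset of the open interval `(-1,1)`. -/
def CompactlySupportedInDom (f : ℝ → ℂ) : Prop :=
  ∃ L : Set ℝ, IsCompact L ∧ L ⊆ dom ∧ ∀ᵐ x ∂domMeasure, x ∉ L → f x = 0

/-- `u ∈ H²(-1,1)` solves `u'' + k² u = f` on `(-1,1)` with the outgoing wave conditions
`u'(-1) + i k u(-1) = 0` and `u'(1) - i k u(1) = 0`. The function `u` is the representative
that is continuous on `[-1,1]`; being in `H²`, it is then `C¹` on `[-1,1]`, so that its values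
and its one-sided derivatives at `±1` are the boundary traces. -/
structure IsOutgoingSolution (k : ℝ) (f u : ℝ → ℂ) : Prop where
  memH2 : MemSobolev 2 u
  continuousOn : ContinuousOn u (Icc (-1) 1)
  equation : ∀ᵐ x ∂domMeasure, weakDeriv (weakDeriv u) x + (k : ℂ) ^ 2 * u x = f x
  outgoing_left : derivWithin u (Icc (-1) 1) (-1) + Complex.I * k * u (-1) = 0
  outgoing_right : derivWithin u (Icc (-1) 1) 1 - Complex.I * k * u 1 = 0

/-- The size `ε` of the multi-frequency boundary data:
`ε² = ∫₀^K k² (|u(1,k)|² + |u(-1,k)|²) dk`. -/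
noncomputable def dataSize (u : ℝ → ℝ → ℂ) (K : ℝ) : ℝ :=
  Real.sqrt (∫ k in (0 : ℝ)..K, k ^ 2 * (‖u 1 k‖ ^ 2 + ‖u (-1) k‖ ^ 2))

/-- `E = - ln ε` for `0 < ε ≤ 1`. For `ε > 1`, where `(- ln ε)^{1/4}` is not a real number,
`E = 0`. -/
noncomputable def logData (ε : ℝ) : ℝ := max (-Real.log ε) 0

/-- `M = max { ‖f‖²_{H¹(-1,1)}, 1 }`. -/
noncomputable def sourceBound (f : ℝ → ℂ) : ℝ := max (sobolevNormSq 1 f) 1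

end HelmholtzSource

/-! The boundary data are the Fourier transform of the source in disguise. Testing `u'' + k²u = f`
with `e^{-isx}`, `s = ±k`, cancels the interior terms, and the outgoing conditions remove one
endpoint for each sign. Hence `|f̂(k)|² + |f̂(-k)|²` is four times the data density, and `4ε²` is
the energy of `f̂` on `(-K,K)` (`IsOutgoingSolution.integral_mul_exp`, `four_mul_dataSize_sq`).

Frequencies beyond a cut-off are controlled by `f' ∈ L²`, since `|ξ||f̂(ξ)|` is dominated by the
transform of a truncation of `f'` (`exists_fourierDom_deriv`). With Parseval on shifted lattices
this gives `integral_sq_le_of_cutoff`. A cut-off near `K` yields `‖f‖² ≤ ε² + 25M/K²`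
(`integral_sq_le_of_four_lt`).

When `ε` is very small, the cut-off can go beyond `K`. Since `f` lives on a bounded interval, `f̂`
is analytic with controlled growth. Instead of complex analysis, Newton's difference formula is
used: low-order differences are small by smallness of `f̂` on `[-1,1]`, high-order ones because
`|e^{-ihx} - 1| ≤ |h|` (`norm_fourierDom_nat_mul_le`). If `ε ≤ exp(-(n-1)^4)`, then `f̂` is of size
`e^{-n}` on `[-πn, πn]`, and `‖f‖² ≲ M/n²` (`integral_sq_le_of_small`).

With `Q = E^{1/4}`, the first estimate suffices if `Q ≤ K^{4/3}`, where `K^{2/3}Q ≤ K²`. Otherwise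
`K^{2/3} ≤ Q`, and `n = ⌈Q⌉` suffices, as `K^{2/3}Q ≤ n²`. -/

namespace HelmholtzSource

open MeasureTheory Set
open scoped ContDiff

/-! ### Fourier transform of a function on `(-1,1)`. -/

/-- The Fourier transform `ξ ↦ ∫_{-1}^1 f(x) e^{-iξx} dx` of a function on `(-1,1)`. -/
noncomputable def fourierDom (f : ℝ → ℂ) (ξ : ℝ) : ℂ :=
  ∫ x, f x * Complex.exp (-(Complex.I * ξ * x)) ∂domMeasure

lemma norm_exp_neg_I_mul (ξ x : ℝ) : ‖Complex.exp (-(Complex.I * ξ * x))‖ = 1 := by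
  have : -(Complex.I * ξ * x) = ((-(ξ * x) : ℝ) : ℂ) * Complex.I := by push_cast; ring
  rw [this, Complex.norm_exp_ofReal_mul_I]

lemma norm_exp_neg_I_mul_sub_one_le (ξ x : ℝ) (hx : |x| ≤ 1) :
    ‖Complex.exp (-(Complex.I * ξ * x)) - 1‖ ≤ |ξ| := by
  have : -(Complex.I * ξ * x) = Complex.I * ((-(ξ * x) : ℝ) : ℂ) := by push_cast; ring
  rw [this]
  refine (Real.norm_exp_I_mul_ofReal_sub_one_le).trans ?_
  rw [norm_neg, Real.norm_eq_abs, abs_mul]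
  exact mul_le_of_le_one_right (abs_nonneg _) hx

lemma ae_domMeasure_abs_le_one : ∀ᵐ x ∂domMeasure, |x| ≤ 1 := by
  filter_upwards [ae_restrict_mem measurableSet_Ioo] with x hx
  exact abs_le.2 ⟨hx.1.le, hx.2.le⟩

lemma integrable_mul_of_norm_le {f g : ℝ → ℂ} (hf : Integrable f domMeasure) (hg : Continuous g)
    {c : ℝ} (hc : ∀ᵐ x ∂domMeasure, ‖g x‖ ≤ c) : Integrable (fun x => f x * g x) domMeasure :=
  hf.mul_bdd (c := c) hg.aestronglyMeasurable hc

lemma norm_integral_mul_le {f g : ℝ → ℂ} (hf : Integrable f domMeasure)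
    {c : ℝ} (hc : ∀ᵐ x ∂domMeasure, ‖g x‖ ≤ c) :
    ‖∫ x, f x * g x ∂domMeasure‖ ≤ c * ∫ x, ‖f x‖ ∂domMeasure := by
  rw [← integral_const_mul]
  refine norm_integral_le_of_norm_le (hf.norm.const_mul c) ?_
  filter_upwards [hc] with x hx
  rw [norm_mul, mul_comm]
  gcongr

lemma fourierDom_integrable {f : ℝ → ℂ} (hf : Integrable f domMeasure) (ξ : ℝ) :
    Integrable (fun x => f x * Complex.exp (-(Complex.I * ξ * x))) domMeasure :=
  integrable_mul_of_norm_le hf (by fun_prop) (c := 1)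
    (Filter.Eventually.of_forall fun x => (norm_exp_neg_I_mul ξ x).le)

/-- The Fourier transform of an integrable function on `(-1,1)` is Lipschitz. -/
lemma norm_fourierDom_sub_le {f : ℝ → ℂ} (hf : Integrable f domMeasure) (s t : ℝ) :
    ‖fourierDom f s - fourierDom f t‖ ≤ |s - t| * ∫ x, ‖f x‖ ∂domMeasure := by
  rw [fourierDom, fourierDom, ← integral_sub (fourierDom_integrable hf s)
    (fourierDom_integrable hf t)]
  simp_rw [← mul_sub]
  refine norm_integral_mul_le hf ?_
  filter_upwards [ae_domMeasure_abs_le_one] with x hx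
  have : Complex.exp (-(Complex.I * s * x)) - Complex.exp (-(Complex.I * t * x)) =
      Complex.exp (-(Complex.I * t * x)) *
        (Complex.exp (-(Complex.I * ((s - t : ℝ) : ℂ) * x)) - 1) := by
    rw [mul_sub, ← Complex.exp_add, mul_one]
    congr 2
    push_cast
    ring
  rw [this, norm_mul, norm_exp_neg_I_mul, one_mul]
  exact norm_exp_neg_I_mul_sub_one_le _ _ hx

lemma continuous_fourierDom {f : ℝ → ℂ} (hf : Integrable f domMeasure) :
    Continuous (fourierDom f) := by
  have : LipschitzWith (∫ x, ‖f x‖ ∂domMeasure).toNNReal (fourierDom f) := by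
    refine LipschitzWith.of_dist_le_mul fun s t => ?_
    rw [dist_eq_norm, Real.dist_eq, Real.coe_toNNReal _ (by positivity), mul_comm]
    exact norm_fourierDom_sub_le hf s t
  exact this.continuous

/-! ### Extrapolation in frequency by finite differences. -/

lemma exp_neg_I_mul_pow (h x : ℝ) (j : ℕ) :
    Complex.exp (-(Complex.I * h * x)) ^ j =
      Complex.exp (-(Complex.I * ((j * h : ℝ) : ℂ) * x)) := by
  rw [← Complex.exp_nat_mul]
  congr 1
  push_cast
  ring

/-- The `k`-th finite difference with step `h`, at frequency `0`, of the Fourier transform. -/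
noncomputable def fourierDiff (f : ℝ → ℂ) (h : ℝ) (k : ℕ) : ℂ :=
  ∫ x, f x * (Complex.exp (-(Complex.I * h * x)) - 1) ^ k ∂domMeasure

lemma norm_fourierDiff_le {f : ℝ → ℂ} (hf : Integrable f domMeasure) (h : ℝ) (k : ℕ) :
    ‖fourierDiff f h k‖ ≤ |h| ^ k * ∫ x, ‖f x‖ ∂domMeasure := by
  refine norm_integral_mul_le hf ?_
  filter_upwards [ae_domMeasure_abs_le_one] with x hx
  rw [norm_pow]
  gcongr
  exact norm_exp_neg_I_mul_sub_one_le _ _ hx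

lemma fourierDiff_integrable {f : ℝ → ℂ} (hf : Integrable f domMeasure) (h : ℝ) (k : ℕ) :
    Integrable (fun x => f x * (Complex.exp (-(Complex.I * h * x)) - 1) ^ k) domMeasure := by
  refine integrable_mul_of_norm_le hf (by fun_prop) (c := |h| ^ k) ?_
  filter_upwards [ae_domMeasure_abs_le_one] with x hx
  rw [norm_pow]
  gcongr
  exact norm_exp_neg_I_mul_sub_one_le _ _ hx

/-- Newton's forward difference formula. -/
lemma fourierDom_nat_mul_eq_sum {f : ℝ → ℂ} (hf : Integrable f domMeasure) (h : ℝ) (m : ℕ) :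
    fourierDom f (m * h) = ∑ k ∈ Finset.range (m + 1), (m.choose k : ℂ) * fourierDiff f h k := by
  simp_rw [fourierDiff, ← integral_const_mul]
  rw [← integral_finsetSum _ fun k _ => (fourierDiff_integrable hf h k).const_mul _, fourierDom]
  refine integral_congr_ae (Filter.Eventually.of_forall fun x => ?_)
  simp only
  rw [← exp_neg_I_mul_pow]
  conv_lhs => rw [← sub_add_cancel (Complex.exp (-(Complex.I * h * x))) 1, add_pow, Finset.mul_sum]
  refine Finset.sum_congr rfl fun k _ => ?_
  simp only [one_pow]
  ring

lemma fourierDiff_eq_sum {f : ℝ → ℂ} (hf : Integrable f domMeasure) (h : ℝ) (k : ℕ) :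
    fourierDiff f h k =
      ∑ j ∈ Finset.range (k + 1), (-1) ^ (k - j) * (k.choose j : ℂ) * fourierDom f (j * h) := by
  simp_rw [fourierDom, ← integral_const_mul]
  rw [← integral_finsetSum _ fun j _ => (fourierDom_integrable hf _).const_mul _, fourierDiff]
  refine integral_congr_ae (Filter.Eventually.of_forall fun x => ?_)
  simp only
  rw [sub_eq_add_neg, add_pow, Finset.mul_sum]
  refine Finset.sum_congr rfl fun j _ => ?_
  rw [exp_neg_I_mul_pow]
  ring

/-- The absolute values of the binomial coefficients in a `k`-th difference sum to `2 ^ k`. -/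
lemma norm_fourierDiff_le_of_small {f : ℝ → ℂ} (hf : Integrable f domMeasure) {h δ : ℝ} {k : ℕ}
    (hδ : ∀ j ≤ k, ‖fourierDom f (j * h)‖ ≤ δ) : ‖fourierDiff f h k‖ ≤ 2 ^ k * δ := by
  rw [fourierDiff_eq_sum hf]
  refine (norm_sum_le _ _).trans ?_
  have : (2 : ℝ) ^ k * δ = ∑ j ∈ Finset.range (k + 1), (k.choose j : ℝ) * δ := by
    rw [← Finset.sum_mul]
    congr 1
    exact_mod_cast (Nat.sum_range_choose k).symm
  rw [this]
  refine Finset.sum_le_sum fun j hj => ?_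
  rw [norm_mul, norm_mul, norm_pow, norm_neg, norm_one, one_pow, one_mul, Complex.norm_natCast]
  gcongr
  exact hδ j (Nat.lt_succ_iff.1 (Finset.mem_range.1 hj))

/-- Extrapolation of smallness of the Fourier transform from the frequencies `j h`, `j < N`, to the
frequency `m h`. -/
lemma norm_fourierDom_nat_mul_le {f : ℝ → ℂ} (hf : Integrable f domMeasure) {h δ : ℝ} {N : ℕ}
    (hδ₀ : 0 ≤ δ) (hδ : ∀ j < N, ‖fourierDom f (j * h)‖ ≤ δ) (m : ℕ) :
    ‖fourierDom f (m * h)‖ ≤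
      3 ^ m * δ + Real.exp (3 * (m * |h|) - N) * ∫ x, ‖f x‖ ∂domMeasure := by
  set B := ∫ x, ‖f x‖ ∂domMeasure
  have hB : 0 ≤ B := by positivity
  -- For `k < N` the samples are small. For `k ≥ N`, `|h|^k` gains `e^{-N}` at the price of `3^k`,
  -- because `e < 3`. The sum of both bounds holds for every `k`, so the binomial theorem applies
  -- without splitting the sum.
  have hdiff : ∀ k, ‖fourierDiff f h k‖ ≤ 2 ^ k * δ + Real.exp (-N) * B * (3 * |h|) ^ k := by
    intro k
    rcases lt_or_ge k N with hk | hk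
    · exact (norm_fourierDiff_le_of_small hf fun j hj => hδ j (by omega)).trans
        (le_add_of_nonneg_right (by positivity))
    · refine (norm_fourierDiff_le hf h k).trans ((?_ : _ ≤ _).trans
        (le_add_of_nonneg_left (by positivity)))
      have h1 : 1 ≤ Real.exp (-N) * 3 ^ k := by
        have h2 : Real.exp k ≤ 3 ^ k := by
          rw [← Real.exp_one_pow]
          gcongr
          exact Real.exp_one_lt_three.le
        calc (1 : ℝ) ≤ Real.exp (-N + k) := Real.one_le_exp (by
              have : (N : ℝ) ≤ k := by exact_mod_cast hk
              linarith)
          _ = Real.exp (-N) * Real.exp k := Real.exp_add _ _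
          _ ≤ _ := by gcongr
      calc |h| ^ k * B ≤ |h| ^ k * B * (Real.exp (-N) * 3 ^ k) :=
            le_mul_of_one_le_right (by positivity) h1
        _ = _ := by rw [mul_pow]; ring
  have hsum : ∀ y : ℝ, ∑ k ∈ Finset.range (m + 1), (m.choose k : ℝ) * y ^ k = (y + 1) ^ m := by
    intro y
    rw [add_pow]
    refine Finset.sum_congr rfl fun k _ => ?_
    rw [one_pow]
    ring
  calc ‖fourierDom f (m * h)‖
      ≤ ∑ k ∈ Finset.range (m + 1), (m.choose k : ℝ) * ‖fourierDiff f h k‖ := by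
        rw [fourierDom_nat_mul_eq_sum hf]
        refine (norm_sum_le _ _).trans_eq (Finset.sum_congr rfl fun k _ => ?_)
        rw [norm_mul, Complex.norm_natCast]
    _ ≤ ∑ k ∈ Finset.range (m + 1),
          (m.choose k : ℝ) * (2 ^ k * δ + Real.exp (-N) * B * (3 * |h|) ^ k) := by
        gcongr with k
        exact hdiff k
    _ = (∑ k ∈ Finset.range (m + 1), (m.choose k : ℝ) * 2 ^ k) * δ +
          (∑ k ∈ Finset.range (m + 1), (m.choose k : ℝ) * (3 * |h|) ^ k) * (Real.exp (-N) * B) := by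
        rw [Finset.sum_mul, Finset.sum_mul, ← Finset.sum_add_distrib]
        exact Finset.sum_congr rfl fun k _ => by ring
    _ = 3 ^ m * δ + (3 * |h| + 1) ^ m * (Real.exp (-N) * B) := by
        rw [hsum, hsum]
        norm_num
    _ ≤ 3 ^ m * δ + Real.exp (3 * |h|) ^ m * (Real.exp (-N) * B) := by
        gcongr
        exact Real.add_one_le_exp _
    _ = _ := by
        rw [← Real.exp_nat_mul, ← mul_assoc, ← Real.exp_add]
        congr 3
        ring

/-- A Lipschitz function that is small in `L²(0,1)` is uniformly small on `[0,1]`. -/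
lemma norm_le_of_lipschitz_of_integral_sq_le {H : ℝ → ℂ} {B ε : ℝ}
    (hH : ∀ s t, ‖H s - H t‖ ≤ |s - t| * B) (hc : Continuous H) (hB : 0 ≤ B) (hε : 0 < ε)
    (hε1 : ε ≤ 1) (hint : ∫ t in (0 : ℝ)..1, ‖H t‖ ^ 2 ≤ 4 * ε ^ 2) {t : ℝ} (ht : t ∈ Icc (0 : ℝ) 1) :
    ‖H t‖ ≤ (3 + B) * √ε := by
  by_contra! hcon
  have hεs : ε ≤ √ε := Real.le_sqrt_of_sq_le (by nlinarith)
  -- An interval of length `ε` in `[0,1]` containing `t`. On it the Lipschitz bound keeps `‖H‖ ≥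
  -- 3√ε`, so the integral of `‖H‖²` is at least `9ε²`, exceeding `4ε²`.
  obtain ⟨a, ha0, ha1, hat, hta⟩ : ∃ a, 0 ≤ a ∧ a + ε ≤ 1 ∧ a ≤ t ∧ t ≤ a + ε := by
    rcases le_total (t + ε) 1 with h | h
    · exact ⟨t, ht.1, h, le_rfl, by linarith⟩
    · exact ⟨1 - ε, by linarith, by linarith, by linarith, by linarith [ht.2]⟩
  have hlow : ∀ s ∈ Icc a (a + ε), 9 * ε ≤ ‖H s‖ ^ 2 := by
    intro s hs
    have h1 : ‖H t‖ ≤ ‖H s‖ + |t - s| * B := by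
      have := norm_sub_norm_le (H t) (H s)
      linarith [hH t s]
    have h2 : |t - s| ≤ ε := abs_le.2 ⟨by linarith [hs.2], by linarith [hs.1]⟩
    have h3 : |t - s| * B ≤ √ε * B := by gcongr; exact h2.trans hεs
    have h4 : 3 * √ε ≤ ‖H s‖ := by nlinarith
    calc 9 * ε = (3 * √ε) ^ 2 := by rw [mul_pow, Real.sq_sqrt hε.le]; norm_num
      _ ≤ _ := by gcongr
  have hi : ∀ p q, IntervalIntegrable (fun t => ‖H t‖ ^ 2) volume p q := fun p q =>
    (hc.norm.pow 2).intervalIntegrable p q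
  have h1 : ∫ _ in a..(a + ε), 9 * ε ≤ ∫ t in a..(a + ε), ‖H t‖ ^ 2 :=
    intervalIntegral.integral_mono_on (by linarith) (by simp) (hi _ _) hlow
  have h2 : ∫ t in a..(a + ε), ‖H t‖ ^ 2 ≤ ∫ t in (0 : ℝ)..1, ‖H t‖ ^ 2 :=
    intervalIntegral.integral_mono_interval ha0 (by linarith) ha1
      (Filter.Eventually.of_forall fun _ => by positivity) (hi _ _)
  rw [intervalIntegral.integral_const, smul_eq_mul] at h1
  nlinarith

/-! ### Parseval's identity on shifted lattices and the frequency cut-off. -/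

lemma restrict_Ioc_eq_domMeasure : volume.restrict (Ioc (-1 : ℝ) 1) = domMeasure :=
  (Measure.restrict_congr_set Ioo_ae_eq_Ioc).symm

lemma intervalIntegral_eq_domMeasure {E : Type*} [NormedAddCommGroup E] [NormedSpace ℝ E]
    (g : ℝ → E) : ∫ x in (-1 : ℝ)..1, g x = ∫ x, g x ∂domMeasure := by
  rw [intervalIntegral.integral_of_le (by norm_num), restrict_Ioc_eq_domMeasure]

/-- Parseval's identity for the samples of the Fourier transform at the points `π n + θ`. -/
lemma hasSum_sq_fourierDom {f : ℝ → ℂ} (hf : MemLp f 2 domMeasure) (θ : ℝ) :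
    HasSum (fun n : ℤ => ‖fourierDom f (Real.pi * n + θ)‖ ^ 2) (2 * ∫ x, ‖f x‖ ^ 2 ∂domMeasure) := by
  have hab : (-1 : ℝ) < 1 := by norm_num
  -- Modulation shifts the frequency by `θ`. On an interval of length 2 the Fourier coefficients are
  -- then half the samples at `πn + θ`.
  set g : ℝ → ℂ := fun x => f x * Complex.exp (-(Complex.I * θ * x)) with hg
  have hgn : ∀ x, ‖g x‖ = ‖f x‖ := fun x => by
    rw [hg]
    simp only
    rw [norm_mul, norm_exp_neg_I_mul, mul_one]
  have hgL : MemLp g 2 (volume.restrict (Ioc (-1 : ℝ) 1)) := by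
    rw [restrict_Ioc_eq_domMeasure]
    refine hf.of_le (hf.1.mul (by fun_prop : Continuous fun x : ℝ =>
      Complex.exp (-(Complex.I * θ * x))).aestronglyMeasurable)
      (Filter.Eventually.of_forall fun x => (hgn x).le)
  have h := (hasSum_sq_fourierCoeffOn hab hgL).mul_left 4
  have hleft : (fun n : ℤ => ‖fourierDom f (Real.pi * n + θ)‖ ^ 2) =
      fun n => 4 * ‖fourierCoeffOn hab g n‖ ^ 2 := by
    funext n
    have : fourierCoeffOn hab g n = (1 / 2 : ℂ) * fourierDom f (Real.pi * n + θ) := by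
      rw [fourierCoeffOn_eq_integral, intervalIntegral_eq_domMeasure, fourierDom]
      have h2 : ((1 / (1 - -1 : ℝ) : ℝ)) = 1 / 2 := by norm_num
      rw [h2, Complex.real_smul]
      push_cast
      congr 1
      refine integral_congr_ae (Filter.Eventually.of_forall fun x => ?_)
      simp only [hg, fourier_coe_apply, smul_eq_mul]
      rw [mul_comm, mul_assoc, ← Complex.exp_add]
      congr 2
      push_cast
      ring
    rw [this, norm_mul, mul_pow]
    norm_num
    ring
  have hright : 2 * ∫ x, ‖f x‖ ^ 2 ∂domMeasure =
      4 * ((1 - -1 : ℝ)⁻¹ • ∫ x in (-1 : ℝ)..1, ‖g x‖ ^ 2) := by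
    simp_rw [hgn]
    rw [intervalIntegral_eq_domMeasure, smul_eq_mul]
    ring
  rw [hleft, hright]
  exact h

/-- Shifting the lattice by `θ - πR` with `θ ∈ [0,π]` puts every sample with `n < 0` or `n ≥ 2R` at
`|ξ| ≥ πR`. There `hfq` compares it with the sample of `q`, and Parseval for `q` sums the tail. -/
lemma two_mul_integral_sq_le_sum {f q : ℝ → ℂ} (hf : MemLp f 2 domMeasure)
    (hq : MemLp q 2 domMeasure) (hfq : ∀ ξ, |ξ| * ‖fourierDom f ξ‖ ≤ ‖fourierDom q ξ‖)
    {R : ℕ} (hR : 0 < R) {θ : ℝ} (hθ : θ ∈ Icc 0 Real.pi) :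
    2 * ∫ x, ‖f x‖ ^ 2 ∂domMeasure ≤
      (∑ k ∈ Finset.range (2 * R), ‖fourierDom f (Real.pi * k + (θ - Real.pi * R))‖ ^ 2) +
        ((Real.pi * R) ^ 2)⁻¹ * (2 * ∫ x, ‖q x‖ ^ 2 ∂domMeasure) := by
  classical
  set s : Finset ℤ := (Finset.range (2 * R)).map Nat.castEmbedding with hs
  set a : ℤ → ℝ := fun n => ‖fourierDom f (Real.pi * n + (θ - Real.pi * R))‖ ^ 2 with ha
  have h1 := hasSum_sq_fourierDom hf (θ - Real.pi * R)
  have h2 := (hasSum_sq_fourierDom hq (θ - Real.pi * R)).mul_left ((Real.pi * R) ^ 2)⁻¹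
  have h3 : HasSum (fun n => if n ∈ s then a n else 0) (∑ n ∈ s, a n) := by
    have h5 : ∑ n ∈ s, a n = ∑ n ∈ s, (if n ∈ s then a n else 0) :=
      Finset.sum_congr rfl fun n hn => by simp [hn]
    rw [h5]
    exact hasSum_sum_of_ne_finset_zero fun n hn => by simp [hn]
  have h4 : ∑ n ∈ s, a n =
      ∑ k ∈ Finset.range (2 * R), ‖fourierDom f (Real.pi * k + (θ - Real.pi * R))‖ ^ 2 := by
    simp [hs, ha]
  rw [← h4]
  have hpi := Real.pi_pos
  have hR' : (0 : ℝ) < R := by exact_mod_cast hR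
  refine hasSum_le (fun n => ?_) h1 (h3.add h2)
  by_cases hn : n ∈ s
  · simp only [hn, if_true]
    exact le_add_of_nonneg_right (by positivity)
  · simp only [hn, if_false, zero_add]
    set ξ := Real.pi * n + (θ - Real.pi * R) with hξ
    have hlow : Real.pi * R ≤ |ξ| := by
      have hn' : n ≤ -1 ∨ (2 * R : ℤ) ≤ n := by
        by_contra! hc
        refine hn (Finset.mem_map.2 ⟨n.toNat, Finset.mem_range.2 (by omega), ?_⟩)
        simp only [Nat.castEmbedding_apply]
        omega
      rcases hn' with h | h
      · have : (n : ℝ) ≤ -1 := by exact_mod_cast h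
        rw [le_abs]
        right
        nlinarith [hθ.2]
      · have : (2 * R : ℝ) ≤ n := by exact_mod_cast h
        rw [le_abs]
        left
        nlinarith [hθ.1]
    rw [← div_eq_inv_mul, le_div_iff₀ (by positivity), ← mul_pow]
    refine pow_le_pow_left₀ (by positivity) ?_ 2
    calc ‖fourierDom f ξ‖ * (Real.pi * R) ≤ ‖fourierDom f ξ‖ * |ξ| := by gcongr
      _ ≤ _ := by rw [mul_comm]; exact hfq ξ

/-- Plancherel's inequality with a frequency cut-off: the frequencies beyond `π R` are controlled
by a function `q` whose Fourier transform dominates `|ξ|` times that of `f`. -/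
lemma integral_sq_le_of_cutoff {f q : ℝ → ℂ} (hf : MemLp f 2 domMeasure)
    (hq : MemLp q 2 domMeasure) (hfq : ∀ ξ, |ξ| * ‖fourierDom f ξ‖ ≤ ‖fourierDom q ξ‖)
    {R : ℕ} (hR : 0 < R) :
    2 * Real.pi * ∫ x, ‖f x‖ ^ 2 ∂domMeasure ≤
      (∫ ξ in (0 : ℝ)..(Real.pi * R), (‖fourierDom f ξ‖ ^ 2 + ‖fourierDom f (-ξ)‖ ^ 2)) +
        2 * Real.pi * ((Real.pi * R) ^ 2)⁻¹ * ∫ x, ‖q x‖ ^ 2 ∂domMeasure := by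
  have hpi := Real.pi_pos
  have hcont : Continuous (fourierDom f) := continuous_fourierDom (hf.integrable one_le_two)
  have hi : ∀ p q, IntervalIntegrable (fun t => ‖fourierDom f t‖ ^ 2) volume p q := fun p q =>
    (hcont.norm.pow 2).intervalIntegrable p q
  have hsplit : (∫ ξ in (0 : ℝ)..(Real.pi * R), (‖fourierDom f ξ‖ ^ 2 + ‖fourierDom f (-ξ)‖ ^ 2)) =
      ∫ ξ in (-(Real.pi * R))..(Real.pi * R), ‖fourierDom f ξ‖ ^ 2 := by
    rw [intervalIntegral.integral_add (hi _ _)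
      (Continuous.intervalIntegrable (u := fun ξ => ‖fourierDom f (-ξ)‖ ^ 2) (by fun_prop) _ _),
      intervalIntegral.integral_comp_neg (fun ξ => ‖fourierDom f ξ‖ ^ 2), neg_zero, add_comm,
      intervalIntegral.integral_add_adjacent_intervals (hi _ _) (hi _ _)]
  -- As `θ` runs over `[0,π]`, the `2R` samples sweep adjacent intervals that tile `[-πR, πR]`.
  have hsum : ∫ θ in (0 : ℝ)..Real.pi,
      (∑ k ∈ Finset.range (2 * R), ‖fourierDom f (Real.pi * k + (θ - Real.pi * R))‖ ^ 2) =
      ∫ ξ in (-(Real.pi * R))..(Real.pi * R), ‖fourierDom f ξ‖ ^ 2 := by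
    rw [intervalIntegral.integral_finsetSum fun k _ =>
      Continuous.intervalIntegrable (by fun_prop) _ _]
    have := intervalIntegral.sum_integral_adjacent_intervals (μ := volume)
      (f := fun t => ‖fourierDom f t‖ ^ 2)
      (a := fun k : ℕ => Real.pi * k - Real.pi * R) (n := 2 * R) (fun k _ => hi _ _)
    convert this using 1
    · refine Finset.sum_congr rfl fun k _ => ?_
      have h5 : ∀ θ : ℝ, Real.pi * k + (θ - Real.pi * R) = θ + (Real.pi * k - Real.pi * R) :=
        fun θ => by ring
      simp_rw [h5]
      rw [intervalIntegral.integral_comp_add_right (fun t => ‖fourierDom f t‖ ^ 2)]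
      congr 1
      · ring
      · push_cast; ring
    · congr 1
      · simp
      · push_cast; ring
  have hmono := intervalIntegral.integral_mono_on (μ := volume) hpi.le
    (intervalIntegrable_const (c := 2 * ∫ x, ‖f x‖ ^ 2 ∂domMeasure))
    (Continuous.intervalIntegrable (by fun_prop) _ _)
    (fun θ hθ => two_mul_integral_sq_le_sum hf hq hfq hR hθ)
  rw [intervalIntegral.integral_add (Continuous.intervalIntegrable (by fun_prop) _ _)
    intervalIntegrable_const, hsum, ← hsplit, intervalIntegral.integral_const,
    intervalIntegral.integral_const] at hmono
  simp only [smul_eq_mul, sub_zero] at hmono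
  linarith

/-! ### Weak derivatives, primitives and integration by parts. -/

lemma intervalIntegral_eq_integral_indicator_Iic (w : ℝ → ℂ) {x : ℝ} (hx : x ∈ dom) :
    ∫ t in (-1 : ℝ)..x, w t = ∫ t, (Iic x).indicator w t ∂domMeasure := by
  rw [intervalIntegral.integral_of_le hx.1.le, integral_indicator measurableSet_Iic,
    Measure.restrict_restrict measurableSet_Iic]
  congr 2
  ext t
  simp only [mem_Ioc, mem_inter_iff, mem_Iic, mem_Ioo]
  exact ⟨fun h => ⟨h.2, h.1, h.2.trans_lt hx.2⟩, fun h => ⟨h.2.1, h.1⟩⟩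

lemma intervalIntegral_eq_integral_indicator_Ici (g : ℝ → ℂ) {t : ℝ} (ht : t ∈ dom) :
    ∫ x in t..1, g x = ∫ x, (Ici t).indicator g x ∂domMeasure := by
  rw [intervalIntegral.integral_of_le ht.2.le, integral_indicator measurableSet_Ici,
    Measure.restrict_restrict measurableSet_Ici, integral_Ioc_eq_integral_Ioo,
    ← integral_Ico_eq_integral_Ioo]
  congr 2
  ext x
  simp only [mem_Ico, mem_inter_iff, mem_Ici, mem_Ioo]
  exact ⟨fun h => ⟨h.1, ht.1.trans_le h.1, h.2⟩, fun h => ⟨h.1, h.2.2⟩⟩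

/-- Fubini's theorem on the triangle `-1 < t ≤ x < 1`. -/
lemma integral_primitive_mul {w g : ℝ → ℂ} (hw : Integrable w domMeasure)
    (hg : Integrable g domMeasure) :
    ∫ x, (∫ t in (-1 : ℝ)..x, w t) * g x ∂domMeasure =
      ∫ t, w t * (∫ x in t..1, g x) ∂domMeasure := by
  have hint : Integrable (Function.uncurry fun x t => (Iic x).indicator w t * g x)
      (domMeasure.prod domMeasure) := by
    have h := ((hg.mul_prod hw).indicator (measurableSet_le measurable_snd measurable_fst))
    refine h.congr (Filter.Eventually.of_forall fun p => ?_)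
    simp only [Function.uncurry, indicator_apply, mem_ofPred_eq, mem_Iic]
    split_ifs <;> ring
  calc ∫ x, (∫ t in (-1 : ℝ)..x, w t) * g x ∂domMeasure
      = ∫ x, ∫ t, (Iic x).indicator w t * g x ∂domMeasure ∂domMeasure := by
        refine integral_congr_ae ?_
        filter_upwards [ae_restrict_mem measurableSet_Ioo] with x hx
        rw [intervalIntegral_eq_integral_indicator_Iic w hx, integral_mul_const]
    _ = ∫ t, ∫ x, (Iic x).indicator w t * g x ∂domMeasure ∂domMeasure :=
        integral_integral_swap hint
    _ = _ := by
        refine integral_congr_ae ?_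
        filter_upwards [ae_restrict_mem measurableSet_Ioo] with t ht
        rw [intervalIntegral_eq_integral_indicator_Ici g ht, ← integral_const_mul]
        refine integral_congr_ae (Filter.Eventually.of_forall fun x => ?_)
        simp only [indicator_apply, mem_Iic, mem_Ici]
        split_ifs <;> ring

lemma integrable_of_continuous {g : ℝ → ℂ} (hg : Continuous g) : Integrable g domMeasure :=
  (hg.continuousOn.integrableOn_Icc (a := -1) (b := 1)).mono_set Ioo_subset_Icc_self

/-- Integration by parts on `(-1,1)` for a primitive of an integrable function. -/
lemma integral_mul_eq_sub_of_primitive {w e e' : ℝ → ℂ} (hw : Integrable w domMeasure) (c : ℂ)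
    (he : ∀ x, HasDerivAt e (e' x) x) (he' : Continuous e') {V : ℝ → ℂ}
    (hV : ∀ x, V x = c + ∫ t in (-1 : ℝ)..x, w t)
    (hVint : Integrable (fun x => V x * e' x) domMeasure) :
    ∫ x, w x * e x ∂domMeasure =
      V 1 * e 1 - V (-1) * e (-1) - ∫ x, V x * e' x ∂domMeasure := by
  have hec : Continuous e := continuous_iff_continuousAt.2 fun x => (he x).continuousAt
  have hftc : ∀ a b : ℝ, ∫ x in a..b, e' x = e b - e a := fun a b =>
    intervalIntegral.integral_eq_sub_of_hasDerivAt (fun x _ => he x) (he'.intervalIntegrable a b)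
  have hwe : Integrable (fun x => w x * e x) domMeasure := by
    obtain ⟨C, hC⟩ := (isCompact_Icc (a := (-1 : ℝ)) (b := 1)).exists_bound_of_continuousOn
      hec.continuousOn
    refine integrable_mul_of_norm_le hw hec (c := C) ?_
    filter_upwards [ae_restrict_mem measurableSet_Ioo] with x hx
    exact hC x (Ioo_subset_Icc_self hx)
  have he'int := integrable_of_continuous he'
  have h1 : ∫ x, (∫ t in (-1 : ℝ)..x, w t) * e' x ∂domMeasure =
      (∫ t, w t ∂domMeasure) * e 1 - ∫ t, w t * e t ∂domMeasure := by
    rw [integral_primitive_mul hw he'int, ← integral_mul_const, ← integral_sub (hw.mul_const _) hwe]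
    simp_rw [hftc, mul_sub]
  have h2 : ∫ x, V x * e' x ∂domMeasure =
      c * (e 1 - e (-1)) + ∫ x, (∫ t in (-1 : ℝ)..x, w t) * e' x ∂domMeasure := by
    rw [← hftc, intervalIntegral_eq_domMeasure, ← integral_const_mul, ← integral_add]
    · refine integral_congr_ae (Filter.Eventually.of_forall fun x => ?_)
      simp only [hV]
      ring
    · exact he'int.const_mul c
    · have := hVint.sub (he'int.const_mul c)
      refine this.congr (Filter.Eventually.of_forall fun x => ?_)
      simp only [hV, Pi.sub_apply]
      ring
  rw [h2, h1, hV 1, hV (-1), intervalIntegral.integral_same, intervalIntegral_eq_domMeasure]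
  ring

lemma ball_zero_one_eq_dom : Metric.ball (0 : ℝ) 1 = dom := by
  rw [Real.ball_eq_Ioo]
  norm_num

/-- A smooth function supported in `(-1,1)` with zero integral has a primitive that is a test
function on `(-1,1)`. -/
lemma exists_primitive_test {φ : ℝ → ℝ} (hφ : ContDiff ℝ ∞ φ) (hsupp : tsupport φ ⊆ dom)
    (hzero : ∫ x, φ x = 0) :
    ∃ Φ : ℝ → ℂ, ContDiff ℝ ∞ Φ ∧ HasCompactSupport Φ ∧ tsupport Φ ⊆ dom ∧
      ∀ x, deriv Φ x = φ x := by
  obtain ⟨r, hr, hsub⟩ := exists_pos_lt_subset_ball one_pos (isClosed_tsupport φ)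
    (hsupp.trans_eq ball_zero_one_eq_dom.symm)
  have hz : ∀ x, r ≤ |x| → φ x = 0 := by
    intro x hx
    by_contra hne
    have := hsub (subset_tsupport φ hne)
    rw [Metric.mem_ball, dist_zero_right, Real.norm_eq_abs] at this
    linarith
  set Ψ : ℝ → ℝ := fun x => ∫ t in (-1 : ℝ)..x, φ t with hΨ
  have hder : ∀ x, HasDerivAt Ψ (φ x) x := fun x =>
    intervalIntegral.integral_hasDerivAt_right (hφ.continuous.intervalIntegrable _ _)
      (hφ.continuous.stronglyMeasurableAtFilter _ _) hφ.continuous.continuousAt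
  have hΨd : ContDiff ℝ ∞ Ψ := by
    rw [contDiff_infty_iff_deriv]
    refine ⟨fun x => (hder x).differentiableAt, ?_⟩
    rwa [show deriv Ψ = φ from funext fun x => (hder x).deriv]
  -- To the left of the support nothing has been integrated. To the right the whole integral has
  -- been, and it is zero.
  have hΨz : ∀ x, r < |x| → Ψ x = 0 := by
    intro x hx
    rcases lt_abs.1 hx with h | h
    · rw [hΨ]
      simp only
      rw [intervalIntegral.integral_eq_integral_of_support_subset, hzero]
      intro t ht
      by_contra hc
      refine ht (hz t ?_)
      rw [mem_Ioc, not_and_or, not_lt, not_le] at hc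
      rcases hc with hc | hc
      · exact le_abs.2 (Or.inr (by linarith [hr.2]))
      · exact le_abs.2 (Or.inl (by linarith))
    · rw [hΨ]
      simp only
      rw [intervalIntegral.integral_congr (g := fun _ => 0), intervalIntegral.integral_zero]
      intro t ht
      refine hz t (le_abs.2 (Or.inr ?_))
      have := ht.2
      have h2 : max (-1) x ≤ -r := max_le (by linarith [hr.2]) (by linarith)
      linarith
  have hsub' : tsupport (fun x => (Ψ x : ℂ)) ⊆ Metric.closedBall 0 r := by
    refine closure_minimal (fun x hx => ?_) Metric.isClosed_closedBall
    rw [Metric.mem_closedBall, dist_zero_right, Real.norm_eq_abs]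
    by_contra! hc
    exact hx (by simp [hΨz x hc])
  refine ⟨fun x => (Ψ x : ℂ), Complex.ofRealCLM.contDiff.comp hΨd,
    (isCompact_closedBall 0 r).of_isClosed_subset (isClosed_tsupport _) hsub',
    hsub'.trans ?_, fun x => (hder x).ofReal_comp.deriv⟩
  rw [← ball_zero_one_eq_dom]
  exact Metric.closedBall_subset_ball hr.2

/-- The du Bois-Reymond lemma on `(-1,1)`. -/
lemma ae_eq_const_of_integral_mul_deriv_eq_zero {v : ℝ → ℂ} (hv : Integrable v domMeasure)
    (h : ∀ Φ : ℝ → ℂ, ContDiff ℝ ∞ Φ → HasCompactSupport Φ → tsupport Φ ⊆ dom →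
      ∫ x, v x * deriv Φ x ∂domMeasure = 0) :
    ∃ c : ℂ, ∀ᵐ x ∂domMeasure, v x = c := by
  let ψ : ContDiffBump (0 : ℝ) := ⟨1 / 4, 1 / 2, by norm_num, by norm_num⟩
  set ψ₀ : ℝ → ℝ := ψ.normed volume with hψ₀
  have hψc : ContDiff ℝ ∞ ψ₀ := ψ.contDiff_normed
  have hψi : ∫ x, ψ₀ x = 1 := ψ.integral_normed
  have hψs : tsupport ψ₀ ⊆ dom := by
    rw [hψ₀, ψ.tsupport_normed_eq, ← ball_zero_one_eq_dom]
    exact Metric.closedBall_subset_ball (by norm_num [ψ])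
  have hψk : HasCompactSupport ψ₀ := ψ.hasCompactSupport_normed
  have hprod : ∀ φ : ℝ → ℝ, Continuous φ → HasCompactSupport φ →
      Integrable (fun x => v x * (φ x : ℂ)) domMeasure := by
    intro φ hφ hk
    obtain ⟨C, hC⟩ := hk.exists_bound_of_continuous hφ
    exact integrable_mul_of_norm_le hv (by fun_prop) (c := C)
      (Filter.Eventually.of_forall fun x => by simpa using hC x)
  set c : ℂ := ∫ x, v x * (ψ₀ x : ℂ) ∂domMeasure with hc
  refine ⟨c, ?_⟩
  -- Subtracting `(∫ φ) ψ₀` makes the integral zero, so the difference is the derivative of a test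
  -- function and is annihilated by `v`.
  have hkey : ∀ φ : ℝ → ℝ, ContDiff ℝ ∞ φ → HasCompactSupport φ → tsupport φ ⊆ dom →
      ∫ x, v x * (φ x : ℂ) ∂domMeasure = (∫ x, φ x : ℝ) * c := by
    intro φ hφ hk hs
    set I : ℝ := ∫ x, φ x
    have hi1 := hφ.continuous.integrable_of_hasCompactSupport hk (μ := volume)
    have hi2 := hψc.continuous.integrable_of_hasCompactSupport hψk (μ := volume)
    obtain ⟨Φ, h1, h2, h3, h4⟩ := exists_primitive_test (φ := fun x => φ x - I * ψ₀ x)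
      (hφ.sub (contDiff_const.mul hψc))
      (by
        refine (tsupport_sub φ fun x => I * ψ₀ x).trans (union_subset hs ?_)
        exact (tsupport_mul_subset_right (f := fun _ => I) (g := ψ₀)).trans hψs)
      (by rw [integral_sub hi1 (hi2.const_mul I), integral_const_mul, hψi, mul_one, sub_self])
    have h5 := h Φ h1 h2 h3
    have h6 : ∀ x, v x * deriv Φ x = v x * (φ x : ℂ) - I * (v x * (ψ₀ x : ℂ)) := by
      intro x
      rw [h4]
      push_cast
      ring
    simp_rw [h6] at h5
    rw [integral_sub (hprod φ hφ.continuous hk) ((hprod ψ₀ hψc.continuous hψk).const_mul _),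
      integral_const_mul, sub_eq_zero] at h5
    exact h5
  have hae := isOpen_Ioo.ae_eq_zero_of_integral_contDiff_smul_eq_zero
    (U := dom) (f := fun x => v x - c) (μ := volume)
    (IntegrableOn.locallyIntegrableOn (hv.sub (integrable_const c))) (by
      intro φ hφ hk hs
      rw [← setIntegral_eq_integral_of_forall_compl_eq_zero (s := dom) (fun x hx => by
        rw [image_eq_zero_of_notMem_tsupport fun hc => hx (hs hc), zero_smul])]
      have h7 : ∀ x, φ x • (v x - c) = v x * (φ x : ℂ) - c * (φ x : ℂ) := by
        intro x
        rw [Complex.real_smul]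
        ring
      have h8 : ∫ x in dom, (φ x : ℂ) = ((∫ x, φ x : ℝ) : ℂ) := by
        rw [setIntegral_eq_integral_of_forall_compl_eq_zero (s := dom) (fun x hx => by
          rw [image_eq_zero_of_notMem_tsupport fun hc => hx (hs hc), Complex.ofReal_zero])]
        exact integral_ofReal
      have hφi : Integrable (fun x => c * (φ x : ℂ)) domMeasure :=
        integrable_of_continuous (by have := hφ.continuous; fun_prop)
      simp_rw [h7]
      rw [integral_sub (hprod φ hφ.continuous hk) hφi, integral_const_mul, h8, hkey φ hφ hk hs,
        mul_comm, sub_self])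
  rw [ae_restrict_iff' measurableSet_Ioo]
  filter_upwards [hae] with x hx hxd
  exact sub_eq_zero.1 (hx hxd)

/-- A function with an integrable weak derivative is a.e. equal to a continuous primitive of it. -/
lemma IsWeakDeriv.exists_primitive {v w : ℝ → ℂ} (h : IsWeakDeriv v w)
    (hv : Integrable v domMeasure) (hw : Integrable w domMeasure) :
    ∃ (c : ℂ) (V : ℝ → ℂ), Continuous V ∧ (∀ᵐ x ∂domMeasure, v x = V x) ∧
      (∀ x ∈ Icc (-1 : ℝ) 1, V x = c + ∫ t in (-1 : ℝ)..x, w t) ∧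
      ∀ e e' : ℝ → ℂ, (∀ x, HasDerivAt e (e' x) x) → Continuous e' →
        ∫ x, w x * e x ∂domMeasure =
          V 1 * e 1 - V (-1) * e (-1) - ∫ x, V x * e' x ∂domMeasure := by
  -- Extension by zero makes `w` integrable on the whole line, hence its primitive continuous
  -- everywhere.
  set w₁ : ℝ → ℂ := dom.indicator w with hw₁
  have hw₁i : Integrable w₁ volume := (integrable_indicator_iff measurableSet_Ioo).2 hw
  have hww : ∀ᵐ x ∂domMeasure, w₁ x = w x := by
    filter_upwards [ae_restrict_mem measurableSet_Ioo] with x hx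
    exact indicator_of_mem hx w
  have hparts : ∀ (c : ℂ) (e e' : ℝ → ℂ), (∀ x, HasDerivAt e (e' x) x) → Continuous e' →
      ∫ x, w x * e x ∂domMeasure =
        (c + ∫ t in (-1 : ℝ)..1, w₁ t) * e 1 - (c + ∫ t in (-1 : ℝ)..(-1), w₁ t) * e (-1) -
          ∫ x, (c + ∫ t in (-1 : ℝ)..x, w₁ t) * e' x ∂domMeasure := by
    intro c e e' he he'
    have hcont : Continuous fun x => (c + ∫ t in (-1 : ℝ)..x, w₁ t) :=
      continuous_const.add
        (intervalIntegral.continuous_primitive (fun a b => hw₁i.intervalIntegrable) _)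
    rw [← integral_mul_eq_sub_of_primitive (hw₁i.restrict (s := dom)) c he he'
      (V := fun x => c + ∫ t in (-1 : ℝ)..x, w₁ t) (fun x => rfl)
      (integrable_of_continuous (hcont.mul he'))]
    refine integral_congr_ae ?_
    filter_upwards [hww] with x hx
    rw [hx]
  have hcont : Continuous fun x => ∫ t in (-1 : ℝ)..x, w₁ t :=
    intervalIntegral.continuous_primitive (fun a b => hw₁i.intervalIntegrable) _
  -- The boundary terms vanish for test functions, so `v` minus the primitive of `w₁` has zero weak
  -- derivative.
  obtain ⟨c, hc⟩ := ae_eq_const_of_integral_mul_deriv_eq_zero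
    (v := fun x => v x - ∫ t in (-1 : ℝ)..x, w₁ t) (hv.sub (integrable_of_continuous hcont)) (by
      intro Φ h1 h2 h3
      have hΦ' : Continuous (deriv Φ) := h1.continuous_deriv (by simp)
      have hb : ∀ x, x ∉ dom → Φ x = 0 := fun x hx =>
        image_eq_zero_of_notMem_tsupport fun hc => hx (h3 hc)
      have h4 := hparts 0 Φ (deriv Φ)
        (fun x => (h1.differentiable (by simp) x).hasDerivAt) hΦ'
      rw [hb 1 (by simp), hb (-1) (by simp)] at h4
      simp only [zero_add, mul_zero, sub_self, zero_sub] at h4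
      have h5 := h.integral_eq Φ h1 h2 h3
      obtain ⟨C, hC⟩ := (h2.deriv).exists_bound_of_continuous hΦ'
      simp_rw [sub_mul]
      rw [integral_sub (integrable_mul_of_norm_le hv hΦ' (Filter.Eventually.of_forall hC))
        (integrable_of_continuous
          (g := fun x => (∫ t in (-1 : ℝ)..x, w₁ t) * deriv Φ x) (hcont.mul hΦ')), h5, h4]
      ring)
  refine ⟨c, fun x => c + ∫ t in (-1 : ℝ)..x, w₁ t, continuous_const.add hcont, ?_, ?_,
    fun e e' => hparts c e e'⟩
  · filter_upwards [hc] with x hx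
    rw [← hx]
    ring
  · intro x hx
    simp only
    congr 1
    rw [intervalIntegral.integral_of_le hx.1, intervalIntegral.integral_of_le hx.1,
      integral_Ioc_eq_integral_Ioo, integral_Ioc_eq_integral_Ioo]
    exact setIntegral_congr_fun measurableSet_Ioo fun t ht =>
      indicator_of_mem (show t ∈ dom from ⟨ht.1, ht.2.trans_le hx.2⟩) w

/-! ### From boundary data to the Fourier transform of the source. -/

lemma hasDerivAt_exp_neg_I_mul (s x : ℝ) :
    HasDerivAt (fun x : ℝ => Complex.exp (-(Complex.I * s * x)))
      (-(Complex.I * s) * Complex.exp (-(Complex.I * s * x))) x := by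
  have h1 : HasDerivAt (fun x : ℝ => -(Complex.I * s * x)) (-(Complex.I * s)) x := by
    simpa using ((Complex.ofRealCLM.hasDerivAt (x := x)).const_mul (Complex.I * s)).fun_neg
  simpa [mul_comm] using h1.cexp

/-- Green's identity for an outgoing solution, tested with `e^{isx}`, `s² = k²`. -/
lemma IsOutgoingSolution.integral_mul_exp {k : ℝ} {f u : ℝ → ℂ} (h : IsOutgoingSolution k f u)
    {s : ℝ} (hs : s ^ 2 = k ^ 2) :
    fourierDom f s =
      Complex.I * (k + s) * u 1 * Complex.exp (-(Complex.I * s)) +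
        Complex.I * (k - s) * u (-1) * Complex.exp (Complex.I * s) := by
  obtain ⟨hu, hwu, hv, hwv, hw⟩ := h.memH2
  set v := weakDeriv u with hvdef
  set w := weakDeriv v with hwdef
  change MemLp w 2 domMeasure at hw
  have hwu' : IsWeakDeriv u v := by
    rw [hvdef, weakDeriv, dif_pos hwu]
    exact hwu.choose_spec
  have hwv' : IsWeakDeriv v w := by
    rw [hwdef, weakDeriv, dif_pos hwv]
    exact hwv.choose_spec
  have hui := hu.integrable one_le_two
  have hvi := hv.integrable one_le_two
  have hwi := hw.integrable one_le_two
  obtain ⟨c, U, hUc, huU, hUp, hUparts⟩ := hwu'.exists_primitive hui hvi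
  obtain ⟨-, V, hVc, hvV, -, hVparts⟩ := hwv'.exists_primitive hvi hwi
  -- Two continuous functions equal a.e. agree on the closed interval, so `U` carries the boundary
  -- values of `u`.
  have huU' : EqOn u U (Icc (-1) 1) :=
    Measure.eqOn_Icc_of_ae_eq volume (by norm_num)
      (by rwa [← Measure.restrict_congr_set Ioo_ae_eq_Icc]) h.continuousOn hUc.continuousOn
  have hUV : ∀ x ∈ Icc (-1 : ℝ) 1, u x = c + ∫ t in (-1 : ℝ)..x, V t := by
    intro x hx
    rw [huU' hx, hUp x hx]
    congr 1
    refine intervalIntegral.integral_congr_ae ?_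
    rw [← ae_restrict_iff' measurableSet_uIoc, uIoc_of_le hx.1]
    have := ae_restrict_of_ae_restrict_of_subset (Ioc_subset_Ioc_right hx.2)
      (restrict_Ioc_eq_domMeasure ▸ hvV)
    exact this
  have hder : ∀ x ∈ Icc (-1 : ℝ) 1, derivWithin u (Icc (-1) 1) x = V x := by
    intro x hx
    have h1 : HasDerivAt (fun x => c + ∫ t in (-1 : ℝ)..x, V t) (V x) x :=
      (intervalIntegral.integral_hasDerivAt_right (hVc.intervalIntegrable _ _)
        (hVc.stronglyMeasurableAtFilter _ _) hVc.continuousAt).const_add c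
    exact (h1.hasDerivWithinAt.congr hUV (hUV x hx)).derivWithin
      (uniqueDiffOn_Icc (by norm_num) x hx)
  have hl := h.outgoing_left
  have hr := h.outgoing_right
  rw [hder _ (by norm_num)] at hl hr
  set e : ℝ → ℂ := fun x => Complex.exp (-(Complex.I * s * x)) with he
  have hed : ∀ x, HasDerivAt e (-(Complex.I * s) * e x) x :=
    hasDerivAt_exp_neg_I_mul s
  have hec : Continuous e := by fun_prop
  -- Since `s² = k²`, `e` solves the homogeneous equation. After two integrations by parts the
  -- integrals of `u` cancel.
  have hed' : ∀ x, HasDerivAt (fun x => -(Complex.I * s) * e x) (-(k : ℂ) ^ 2 * e x) x := by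
    intro x
    refine ((hed x).const_mul (-(Complex.I * s))).congr_deriv ?_
    have hs' : (s : ℂ) ^ 2 = (k : ℂ) ^ 2 := by exact_mod_cast hs
    linear_combination (-e x) * hs' + ((s : ℂ) ^ 2 * e x) * Complex.I_sq
  have p1 := hVparts e _ hed (by fun_prop)
  have p2 := hUparts _ _ hed' (by fun_prop)
  have q1 : ∫ x, V x * (-(Complex.I * s) * e x) ∂domMeasure =
      ∫ x, v x * (-(Complex.I * s) * e x) ∂domMeasure := by
    refine integral_congr_ae ?_
    filter_upwards [hvV] with x hx
    rw [hx]
  have q2 : ∫ x, U x * (-(k : ℂ) ^ 2 * e x) ∂domMeasure =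
      -(k : ℂ) ^ 2 * ∫ x, u x * e x ∂domMeasure := by
    rw [← integral_const_mul]
    refine integral_congr_ae ?_
    filter_upwards [huU] with x hx
    rw [hx]
    ring
  have hF : fourierDom f s =
      ∫ x, w x * e x ∂domMeasure + (k : ℂ) ^ 2 * ∫ x, u x * e x ∂domMeasure := by
    have hen : ∀ᵐ x ∂domMeasure, ‖e x‖ ≤ 1 :=
      Filter.Eventually.of_forall fun x => (norm_exp_neg_I_mul s x).le
    rw [← integral_const_mul, ← integral_add (integrable_mul_of_norm_le hwi hec hen)
      ((integrable_mul_of_norm_le hui hec hen).const_mul _), fourierDom]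
    refine integral_congr_ae ?_
    filter_upwards [h.equation] with x hx
    rw [← hx]
    ring
  have e1 : e 1 = Complex.exp (-(Complex.I * s)) := by simp [he]
  have e2 : e (-1) = Complex.exp (Complex.I * s) := by simp [he]
  rw [← e1, ← e2, hF, p1, q1, p2, q2, huU' (by norm_num : (1 : ℝ) ∈ Icc (-1 : ℝ) 1),
    huU' (by norm_num : (-1 : ℝ) ∈ Icc (-1 : ℝ) 1)]
  rw [huU' (by norm_num : (1 : ℝ) ∈ Icc (-1 : ℝ) 1)] at hr
  rw [huU' (by norm_num : (-1 : ℝ) ∈ Icc (-1 : ℝ) 1)] at hl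
  -- Only boundary terms remain, and the outgoing conditions express `V (±1)` through `U (±1)`.
  linear_combination e 1 * hr - e (-1) * hl

lemma norm_exp_I_mul (s : ℝ) : ‖Complex.exp (Complex.I * s)‖ = 1 := by
  rw [mul_comm, Complex.norm_exp_ofReal_mul_I]

/-- The boundary data of an outgoing solution determine the Fourier transform of the source. -/
lemma IsOutgoingSolution.sq_norm_fourierDom_add {k : ℝ} {f u : ℝ → ℂ}
    (h : IsOutgoingSolution k f u) :
    ‖fourierDom f k‖ ^ 2 + ‖fourierDom f (-k)‖ ^ 2 =
      4 * (k ^ 2 * (‖u 1‖ ^ 2 + ‖u (-1)‖ ^ 2)) := by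
  have h1 := h.integral_mul_exp (s := k) rfl
  have h2 := h.integral_mul_exp (s := -k) (neg_sq k)
  have h3 : ‖Complex.exp (-(Complex.I * k))‖ = 1 := by
    simpa using norm_exp_I_mul (-k)
  have h4 : ‖fourierDom f k‖ = 2 * |k| * ‖u 1‖ := by
    rw [h1, sub_self, mul_zero, zero_mul, zero_mul, add_zero, norm_mul, h3, mul_one, norm_mul,
      norm_mul, Complex.norm_I, one_mul, ← two_mul, norm_mul, Complex.norm_real]
    simp
  have h5 : ‖fourierDom f (-k)‖ = 2 * |k| * ‖u (-1)‖ := by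
    have h6 : Complex.I * ((-k : ℝ) : ℂ) = -(Complex.I * k) := by push_cast; ring
    rw [h2, h6, Complex.ofReal_neg, add_neg_cancel, mul_zero, zero_mul, zero_mul, zero_add,
      sub_neg_eq_add, norm_mul, h3, mul_one, norm_mul,
      norm_mul, Complex.norm_I, one_mul, ← two_mul, norm_mul, Complex.norm_real]
    simp
  rw [h4, h5, mul_pow, mul_pow, mul_pow, mul_pow, sq_abs]
  ring

/-- The pointwise identity also shows that the integrand in `dataSize` agrees with a continuous
function on `(0,K)`. So its integral is never the default value `0` of a non-integrable function. -/
lemma four_mul_dataSize_sq {K : ℝ} {f : ℝ → ℂ} {u : ℝ → ℝ → ℂ} (hK : 0 ≤ K)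
    (h : ∀ k ∈ Ioo (0 : ℝ) K, IsOutgoingSolution k f (fun x => u x k)) :
    4 * dataSize u K ^ 2 =
      ∫ k in (0 : ℝ)..K, (‖fourierDom f k‖ ^ 2 + ‖fourierDom f (-k)‖ ^ 2) := by
  rw [dataSize, Real.sq_sqrt (intervalIntegral.integral_nonneg hK fun k _ => by positivity),
    ← intervalIntegral.integral_const_mul, intervalIntegral.integral_of_le hK,
    intervalIntegral.integral_of_le hK, integral_Ioc_eq_integral_Ioo, integral_Ioc_eq_integral_Ioo]
  exact setIntegral_congr_fun measurableSet_Ioo fun k hk => (h k hk).sq_norm_fourierDom_add.symm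

/-! ### A priori bounds from the Sobolev norm. -/

/-- For `f ∈ H¹(-1,1)` with compact support, `|ξ|` times the Fourier transform of `f` is dominated
by the Fourier transform of a function no larger than the weak derivative of `f`. -/
lemma exists_fourierDom_deriv {f : ℝ → ℂ} (hf : MemSobolev 1 f) (hs : CompactlySupportedInDom f) :
    ∃ q : ℝ → ℂ, MemLp q 2 domMeasure ∧
      ∫ x, ‖q x‖ ^ 2 ∂domMeasure ≤ ∫ x, ‖weakDeriv f x‖ ^ 2 ∂domMeasure ∧
      ∀ ξ, |ξ| * ‖fourierDom f ξ‖ ≤ ‖fourierDom q ξ‖ := by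
  obtain ⟨hf2, hwf, hg⟩ := hf
  obtain ⟨L, hLc, hLd, hL⟩ := hs
  set g := weakDeriv f with hgdef
  change MemLp g 2 domMeasure at hg
  have hfg : IsWeakDeriv f g := by
    rw [hgdef, weakDeriv, dif_pos hwf]
    exact hwf.choose_spec
  obtain ⟨r, hr, hLr⟩ := exists_pos_lt_subset_ball one_pos hLc.isClosed
    (hLd.trans_eq ball_zero_one_eq_dom.symm)
  -- An exponential is not a test function, but its product with `χ` is. As `χ = 1` near `L`, where
  -- `f` lives, the cut-off does not affect the pairing with `f`; it only replaces the weak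
  -- derivative `g` by `q = gχ`.
  let χ : ContDiffBump (0 : ℝ) := ⟨r, (1 + r) / 2, hr.1, by linarith [hr.2]⟩
  have hχ1 : ∀ x, ‖(χ x : ℂ)‖ ≤ 1 := fun x => by
    rw [Complex.norm_real, Real.norm_of_nonneg χ.nonneg]
    exact χ.le_one
  have hχs : tsupport χ ⊆ dom := by
    rw [χ.tsupport_eq, ← ball_zero_one_eq_dom]
    exact Metric.closedBall_subset_ball (by change (1 + r) / 2 < 1; linarith [hr.2])
  have hχc : ContDiff ℝ ∞ χ := χ.contDiff
  have hcont : Continuous fun x => (χ x : ℂ) := by have := hχc.continuous; fun_prop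
  have hqle : ∀ x, ‖g x * (χ x : ℂ)‖ ≤ ‖g x‖ := fun x => by
    rw [norm_mul]
    exact mul_le_of_le_one_right (norm_nonneg _) (hχ1 x)
  have hq : MemLp (fun x => g x * (χ x : ℂ)) 2 domMeasure :=
    hg.of_le (hg.1.mul hcont.aestronglyMeasurable) (Filter.Eventually.of_forall hqle)
  refine ⟨fun x => g x * (χ x : ℂ), hq, ?_, fun ξ => ?_⟩
  · exact integral_mono hq.integrable_norm_pow' hg.integrable_norm_pow' fun x =>
      pow_le_pow_left₀ (norm_nonneg _) (hqle x) 2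
  · set e : ℝ → ℂ := fun x => Complex.exp (-(Complex.I * ξ * x)) with he
    have hed : ∀ x, HasDerivAt e (-(Complex.I * ξ) * e x) x :=
      hasDerivAt_exp_neg_I_mul ξ
    have heC : ContDiff ℝ ∞ e := by
      have : ContDiff ℝ ∞ fun x : ℝ => (x : ℂ) := Complex.ofRealCLM.contDiff
      exact (contDiff_const.mul this).neg.cexp
    have hφs : tsupport (fun x => (χ x : ℂ) * e x) ⊆ tsupport χ :=
      closure_mono fun x hx hc => hx (by
        have : (χ x : ℝ) = 0 := hc
        simp [this])
    have h1 := hfg.integral_eq (fun x => (χ x : ℂ) * e x)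
      ((Complex.ofRealCLM.contDiff.comp hχc).mul heC)
      (χ.hasCompactSupport.of_isClosed_subset (isClosed_tsupport _) hφs) (hφs.trans hχs)
    have h2 : ∫ x, f x * deriv (fun x => (χ x : ℂ) * e x) x ∂domMeasure =
        -(Complex.I * ξ) * fourierDom f ξ := by
      rw [fourierDom, ← integral_const_mul]
      refine integral_congr_ae ?_
      filter_upwards [hL] with x hx
      by_cases hxL : x ∈ L
      · have h3 : (fun x => (χ x : ℂ) * e x) =ᶠ[nhds x] e := by
          filter_upwards [Metric.isOpen_ball.mem_nhds (hLr hxL)] with y hy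
          rw [χ.one_of_mem_closedBall (Metric.ball_subset_closedBall hy), Complex.ofReal_one,
            one_mul]
        rw [h3.deriv_eq, (hed x).deriv]
        ring
      · simp [hx hxL]
    have h3 : ∫ x, g x * ((χ x : ℂ) * e x) ∂domMeasure =
        fourierDom (fun x => g x * (χ x : ℂ)) ξ := by
      rw [fourierDom]
      exact integral_congr_ae (Filter.Eventually.of_forall fun x => (mul_assoc _ _ _).symm)
    rw [h2, h3] at h1
    have h4 := congrArg norm h1
    rw [norm_mul, norm_neg, norm_neg, norm_mul, Complex.norm_I, one_mul, Complex.norm_real,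
      Real.norm_eq_abs] at h4
    exact h4.le

/-- Cauchy–Schwarz on an interval of length 2, read off from the nonnegative variance of `‖f‖` about
its mean `B / 2`. -/
lemma sq_integral_norm_le {f : ℝ → ℂ} (hf : MemLp f 2 domMeasure) :
    (∫ x, ‖f x‖ ∂domMeasure) ^ 2 ≤ 2 * ∫ x, ‖f x‖ ^ 2 ∂domMeasure := by
  set B := ∫ x, ‖f x‖ ∂domMeasure with hB
  have h1 : Integrable (fun x => ‖f x‖) domMeasure := (hf.integrable one_le_two).norm
  have h2 : Integrable (fun x => ‖f x‖ ^ 2) domMeasure := hf.integrable_norm_pow'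
  have h3 : 0 ≤ ∫ x, (‖f x‖ - B / 2) ^ 2 ∂domMeasure := by positivity
  have h4 : ∫ x, (‖f x‖ - B / 2) ^ 2 ∂domMeasure =
      (∫ x, ‖f x‖ ^ 2 ∂domMeasure) - B * B + 2 * (B / 2) ^ 2 := by
    have h5 : ∀ x, (‖f x‖ - B / 2) ^ 2 = ‖f x‖ ^ 2 - B * ‖f x‖ + (B / 2) ^ 2 := fun x => by ring
    simp_rw [h5]
    rw [integral_add (f := fun x => ‖f x‖ ^ 2 - B * ‖f x‖) (h2.sub (h1.const_mul B))
        (integrable_const _),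
      integral_sub h2 (h1.const_mul B), integral_const_mul, ← hB, integral_const]
    norm_num [Measure.real]
  nlinarith

/-! ### The low-frequency and high-frequency estimates. -/

/-- Smallness of the data at the frequencies in `[-1,1]` extends to the frequencies in
`[-π n, π n]`. -/
lemma norm_fourierDom_le_of_small {f : ℝ → ℂ} (hf : Integrable f domMeasure) {n : ℕ} (hn : 1 ≤ n)
    (hsmall : ∫ ξ in (0 : ℝ)..1, (‖fourierDom f ξ‖ ^ 2 + ‖fourierDom f (-ξ)‖ ^ 2) ≤
      4 * Real.exp (-((n : ℝ) - 1) ^ 4) ^ 2) {ξ : ℝ} (hξ : |ξ| ≤ Real.pi * n) :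
    ‖fourierDom f ξ‖ ≤
      (3 + ∫ x, ‖f x‖ ∂domMeasure) * (Real.exp 40000 + 1) * Real.exp (-n) := by
  set B := ∫ x, ‖f x‖ ∂domMeasure
  set ε := Real.exp (-((n : ℝ) - 1) ^ 4) with hε
  have hB : 0 ≤ B := by positivity
  have hn' : (1 : ℝ) ≤ n := by exact_mod_cast hn
  have hε1 : ε ≤ 1 := Real.exp_le_one_iff.2 (by
    have : (0 : ℝ) ≤ ((n : ℝ) - 1) ^ 4 := by positivity
    linarith)
  have hsε : √ε = Real.exp (-((n : ℝ) - 1) ^ 4 / 2) := by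
    rw [hε, Real.exp_half]
  have hcont := continuous_fourierDom hf
  have hlow : ∀ t, |t| ≤ 1 → ‖fourierDom f t‖ ≤ (3 + B) * √ε := by
    have hpos : ∀ t ∈ Icc (0 : ℝ) 1, ‖fourierDom f t‖ ≤ (3 + B) * √ε := fun t ht =>
      norm_le_of_lipschitz_of_integral_sq_le (norm_fourierDom_sub_le hf) hcont hB
        (Real.exp_pos _) hε1 ((intervalIntegral.integral_mono_on zero_le_one
          (Continuous.intervalIntegrable (by fun_prop) _ _)
          (Continuous.intervalIntegrable (by fun_prop) _ _)
          fun t _ => le_add_of_nonneg_right (by positivity)).trans hsmall) ht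
    have hneg : ∀ t ∈ Icc (0 : ℝ) 1, ‖fourierDom f (-t)‖ ≤ (3 + B) * √ε := fun t ht =>
      norm_le_of_lipschitz_of_integral_sq_le (H := fun t => fourierDom f (-t))
        (fun s t => by
          refine (norm_fourierDom_sub_le hf (-s) (-t)).trans_eq ?_
          rw [neg_sub_neg, abs_sub_comm]) (by fun_prop) hB
        (Real.exp_pos _) hε1 ((intervalIntegral.integral_mono_on zero_le_one
          (Continuous.intervalIntegrable (by fun_prop) _ _)
          (Continuous.intervalIntegrable (by fun_prop) _ _)
          fun t _ => le_add_of_nonneg_left (by positivity)).trans hsmall) ht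
    intro t ht
    rcases le_total 0 t with h | h
    · exact hpos t ⟨h, (le_abs_self t).trans ht⟩
    · simpa using hneg (-t) ⟨by linarith, (neg_le_abs t).trans ht⟩
  -- With `m = 64n²` steps of size `ξ / m` and `|ξ| ≤ 4n`, the first `N = 16n` nodes stay in
  -- `[-1,1]`. The remainder exponent is at most `3·4n - 16n ≤ -n`.
  set m : ℕ := 64 * n ^ 2 with hm
  have hm' : (m : ℝ) = 64 * n ^ 2 := by rw [hm]; push_cast; rfl
  have hm0 : (0 : ℝ) < m := by rw [hm']; positivity
  have hξ4 : |ξ| ≤ 4 * n := hξ.trans (by gcongr; exact Real.pi_le_four)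
  have hmain := norm_fourierDom_nat_mul_le hf (h := ξ / m) (δ := (3 + B) * √ε) (N := 16 * n)
    (by positivity) (fun j hj => hlow _ (by
      have hj' : (j : ℝ) ≤ 16 * n := by exact_mod_cast hj.le
      rw [abs_mul, abs_div, Nat.abs_cast, Nat.abs_cast, ← mul_div_assoc, div_le_one hm0, hm']
      calc (j : ℝ) * |ξ| ≤ 16 * n * (4 * n) := by gcongr
        _ = _ := by ring)) m
  rw [mul_div_cancel₀ _ hm0.ne', abs_div, Nat.abs_cast, mul_div_cancel₀ _ hm0.ne'] at hmain
  -- The loss `3^m` costs `128n²` in the exponent and `√ε` gains `(n-1)^4/2`. The quartic wins up to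
  -- an additive constant, for which `40000` is enough.
  have h3 : (3 : ℝ) ^ m * √ε ≤ Real.exp 40000 * Real.exp (-n) := by
    have h4 : (3 : ℝ) ≤ Real.exp 2 := by linarith [Real.add_one_le_exp (2 : ℝ)]
    calc (3 : ℝ) ^ m * √ε ≤ Real.exp 2 ^ m * √ε := by gcongr
      _ = Real.exp (m * 2 + -((n : ℝ) - 1) ^ 4 / 2) := by
          rw [← Real.exp_nat_mul, hsε, Real.exp_add]
      _ ≤ Real.exp (40000 + -n) := by
          refine Real.exp_le_exp.2 ?_
          rw [hm']
          nlinarith [sq_nonneg (((n : ℝ) - 1) ^ 2 - 258), sq_nonneg ((n : ℝ) - 2)]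
      _ = _ := Real.exp_add _ _
  have h4 : Real.exp (3 * |ξ| - (16 * n : ℕ)) ≤ Real.exp (-n) := by
    gcongr
    push_cast
    linarith
  calc ‖fourierDom f ξ‖ ≤ (3 + B) * (3 ^ m * √ε) + Real.exp (3 * |ξ| - (16 * n : ℕ)) * B := by
        linarith
    _ ≤ (3 + B) * (Real.exp 40000 * Real.exp (-n)) + Real.exp (-n) * (3 + B) := by
        gcongr
        linarith
    _ = _ := by ring

/-- Smallness of the low-frequency data bounds the source. -/
lemma integral_sq_le_of_small {f q : ℝ → ℂ} (hf : MemLp f 2 domMeasure)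
    (hq : MemLp q 2 domMeasure) (hfq : ∀ ξ, |ξ| * ‖fourierDom f ξ‖ ≤ ‖fourierDom q ξ‖)
    {M : ℝ} (hM : 1 ≤ M) (hfM : ∫ x, ‖f x‖ ^ 2 ∂domMeasure ≤ M)
    (hqM : ∫ x, ‖q x‖ ^ 2 ∂domMeasure ≤ M) {n : ℕ} (hn : 1 ≤ n)
    (hsmall : ∫ ξ in (0 : ℝ)..1, (‖fourierDom f ξ‖ ^ 2 + ‖fourierDom f (-ξ)‖ ^ 2) ≤
      4 * Real.exp (-((n : ℝ) - 1) ^ 4) ^ 2) :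
    ∫ x, ‖f x‖ ^ 2 ∂domMeasure ≤ (22 * (Real.exp 40000 + 1) ^ 2 + 1) * M / n ^ 2 := by
  have hfi := hf.integrable one_le_two
  have hcont := continuous_fourierDom hfi
  have hn' : (1 : ℝ) ≤ n := by exact_mod_cast hn
  have hpi := Real.pi_pos
  set B := ∫ x, ‖f x‖ ∂domMeasure with hBdef
  have hB : 0 ≤ B := by positivity
  set A := Real.exp 40000 + 1
  have hA : 0 < A := by positivity
  -- From `(3 + B)² ≤ 2(9 + B²)`, `B² ≤ 2M` and `1 ≤ M`.
  have hB2 : (3 + B) ^ 2 ≤ 22 * M := by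
    have := sq_integral_norm_le hf
    nlinarith [sq_nonneg (3 - B)]
  -- The power 3 is chosen so that integration over a range of length `πn` leaves `n^{-2}`, the rate
  -- of the tail.
  have hexp : Real.exp (-n) ^ 2 ≤ 1 / (n : ℝ) ^ 3 := by
    have h1 := Real.pow_div_factorial_le_exp (2 * n : ℝ) (by positivity) 3
    have h2 : Real.exp (-n) ^ 2 = (Real.exp (2 * n))⁻¹ := by
      rw [← Real.exp_nat_mul, ← Real.exp_neg]
      congr 1
      push_cast
      ring
    rw [h2, ← one_div]
    refine one_div_le_one_div_of_le (by positivity) (le_trans ?_ h1)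
    have h3 : (Nat.factorial 3 : ℝ) = 6 := by norm_num [Nat.factorial]
    have h4 : (0 : ℝ) ≤ n ^ 3 := by positivity
    rw [h3, mul_pow]
    linarith
  have hpt : ∀ ξ, |ξ| ≤ Real.pi * n → ‖fourierDom f ξ‖ ^ 2 ≤ 22 * M * A ^ 2 / n ^ 3 := by
    intro ξ hξ
    calc ‖fourierDom f ξ‖ ^ 2 ≤ ((3 + B) * A * Real.exp (-n)) ^ 2 := by
          gcongr
          exact norm_fourierDom_le_of_small hfi hn hsmall hξ
      _ = (3 + B) ^ 2 * A ^ 2 * Real.exp (-n) ^ 2 := by ring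
      _ ≤ 22 * M * A ^ 2 * (1 / n ^ 3) := by gcongr
      _ = _ := by ring
  have hint : ∫ ξ in (0 : ℝ)..(Real.pi * n), (‖fourierDom f ξ‖ ^ 2 + ‖fourierDom f (-ξ)‖ ^ 2) ≤
      Real.pi * n * (2 * (22 * M * A ^ 2 / n ^ 3)) := by
    have h1 := intervalIntegral.integral_mono_on (μ := volume)
      (f := fun ξ => ‖fourierDom f ξ‖ ^ 2 + ‖fourierDom f (-ξ)‖ ^ 2)
      (g := fun _ => 2 * (22 * M * A ^ 2 / n ^ 3))
      (by positivity : (0 : ℝ) ≤ Real.pi * n)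
      (Continuous.intervalIntegrable (by fun_prop) _ _) (by simp) (fun ξ hξ => by
        have h2 : |ξ| ≤ Real.pi * n := by rw [abs_of_nonneg hξ.1]; exact hξ.2
        have h3 := hpt ξ h2
        have h4 := hpt (-ξ) (by rwa [abs_neg])
        linarith)
    rwa [intervalIntegral.integral_const, smul_eq_mul, sub_zero] at h1
  have hcut := integral_sq_le_of_cutoff hf hq hfq (R := n) hn
  have htail : 2 * Real.pi * ((Real.pi * n) ^ 2)⁻¹ * ∫ x, ‖q x‖ ^ 2 ∂domMeasure ≤
      2 * Real.pi * (M / n ^ 2) := by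
    have h1 : ((Real.pi * n) ^ 2)⁻¹ ≤ ((n : ℝ) ^ 2)⁻¹ := by
      gcongr
      nlinarith [Real.pi_gt_three]
    calc 2 * Real.pi * ((Real.pi * n) ^ 2)⁻¹ * ∫ x, ‖q x‖ ^ 2 ∂domMeasure
        ≤ 2 * Real.pi * ((n : ℝ) ^ 2)⁻¹ * M := by gcongr
      _ = _ := by ring
  have hfin : 2 * Real.pi * ∫ x, ‖f x‖ ^ 2 ∂domMeasure ≤
      2 * Real.pi * ((22 * A ^ 2 + 1) * M / n ^ 2) := by
    refine hcut.trans ((add_le_add hint htail).trans_eq ?_)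
    field_simp
  exact le_of_mul_le_mul_left hfin (by positivity)

/-- The high-frequency tail is controlled by the a priori bound. -/
lemma integral_sq_le_of_four_lt {f q : ℝ → ℂ} (hf : MemLp f 2 domMeasure)
    (hq : MemLp q 2 domMeasure) (hfq : ∀ ξ, |ξ| * ‖fourierDom f ξ‖ ≤ ‖fourierDom q ξ‖)
    {M : ℝ} (hqM : ∫ x, ‖q x‖ ^ 2 ∂domMeasure ≤ M) {K ε : ℝ} (hK : 4 < K)
    (hdata : ∫ ξ in (0 : ℝ)..K, (‖fourierDom f ξ‖ ^ 2 + ‖fourierDom f (-ξ)‖ ^ 2) = 4 * ε ^ 2) :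
    ∫ x, ‖f x‖ ^ 2 ∂domMeasure ≤ ε ^ 2 + 25 * M / K ^ 2 := by
  have hcont := continuous_fourierDom (hf.integrable one_le_two)
  have hpi := Real.pi_pos
  have hpi3 := Real.pi_gt_three
  have hpi4 := Real.pi_lt_d2
  have hq0 : 0 ≤ ∫ x, ‖q x‖ ^ 2 ∂domMeasure := by positivity
  set R := ⌊K / Real.pi⌋₊ with hRdef
  have hR1 : Real.pi * R ≤ K := by
    have := Nat.floor_le (div_nonneg (by linarith : 0 ≤ K) hpi.le)
    rwa [le_div_iff₀ hpi, mul_comm] at this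
  -- `πR > K - π`, and `π ≤ 4K/5` because `K > 4`.
  have hR2 : K / 5 ≤ Real.pi * R := by
    have := Nat.lt_floor_add_one (K / Real.pi)
    rw [div_lt_iff₀ hpi] at this
    nlinarith
  have hR : 0 < R := by
    rcases Nat.eq_zero_or_pos R with h | h
    · rw [h] at hR2
      norm_num at hR2
      linarith
    · exact h
  have hcut := integral_sq_le_of_cutoff hf hq hfq hR
  have hint : ∫ ξ in (0 : ℝ)..(Real.pi * R), (‖fourierDom f ξ‖ ^ 2 + ‖fourierDom f (-ξ)‖ ^ 2) ≤
      4 * ε ^ 2 := by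
    rw [← hdata]
    exact intervalIntegral.integral_mono_interval le_rfl (by positivity) hR1
      (Filter.Eventually.of_forall fun _ => by positivity)
      (Continuous.intervalIntegrable (by fun_prop) _ _)
  have htail : 2 * Real.pi * ((Real.pi * R) ^ 2)⁻¹ * ∫ x, ‖q x‖ ^ 2 ∂domMeasure ≤
      2 * Real.pi * (25 * M / K ^ 2) := by
    calc 2 * Real.pi * ((Real.pi * R) ^ 2)⁻¹ * ∫ x, ‖q x‖ ^ 2 ∂domMeasure
        ≤ 2 * Real.pi * ((K / 5) ^ 2)⁻¹ * M := by gcongr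
      _ = _ := by field_simp; ring
  have hfin : 2 * Real.pi * ∫ x, ‖f x‖ ^ 2 ∂domMeasure ≤
      2 * Real.pi * (ε ^ 2 + 25 * M / K ^ 2) := by
    -- The data term `4ε²` fits because `4 ≤ 2π`.
    nlinarith [sq_nonneg ε]
  exact le_of_mul_le_mul_left hfin (by positivity)

end HelmholtzSource

/-! ### Balancing the two estimates. -/

theorem theorem1p1 :
    ∃ C : ℝ, 0 < C ∧
      ∀ (K : ℝ) (f : ℝ → ℂ) (u : ℝ → ℝ → ℂ),
        1 < K →
        HelmholtzSource.MemSobolev 1 f →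
        HelmholtzSource.CompactlySupportedInDom f →
        (∀ ω ∈ Set.Ioo (0 : ℝ) K,
          HelmholtzSource.IsOutgoingSolution ω f (fun x => u x ω)) →
        (0 < HelmholtzSource.dataSize u K →
          HelmholtzSource.sobolevNormSq 0 f ≤
            C * (HelmholtzSource.dataSize u K ^ 2 +
              HelmholtzSource.sourceBound f ^ 2 /
                (K ^ (2 / 3 : ℝ) *
                    HelmholtzSource.logData (HelmholtzSource.dataSize u K) ^ (1 / 4 : ℝ) + 1))) ∧
        (HelmholtzSource.dataSize u K = 0 →
          ∀ᵐ x ∂HelmholtzSource.domMeasure, f x = 0) := by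
  set C₁ : ℝ := 22 * (Real.exp 40000 + 1) ^ 2 + 1 with hC₁
  have hC₁0 : 0 < C₁ := by positivity
  refine ⟨2 * C₁ + 50, by positivity, fun K f u hK hf hs hu => ?_⟩
  obtain ⟨q, hq, hqg, hfq⟩ := HelmholtzSource.exists_fourierDom_deriv hf hs
  have hf2 : MeasureTheory.MemLp f 2 HelmholtzSource.domMeasure := hf.1
  set ε := HelmholtzSource.dataSize u K with hε
  set M := HelmholtzSource.sourceBound f with hMdef
  have hM : 1 ≤ M := le_max_right _ _
  have hfM' : (∫ x, ‖f x‖ ^ 2 ∂HelmholtzSource.domMeasure) +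
      ∫ x, ‖HelmholtzSource.weakDeriv f x‖ ^ 2 ∂HelmholtzSource.domMeasure ≤ M := le_max_left _ _
  have hf0 : 0 ≤ ∫ x, ‖f x‖ ^ 2 ∂HelmholtzSource.domMeasure := by positivity
  have hg0 : 0 ≤ ∫ x, ‖HelmholtzSource.weakDeriv f x‖ ^ 2 ∂HelmholtzSource.domMeasure := by
    positivity
  have hfM : ∫ x, ‖f x‖ ^ 2 ∂HelmholtzSource.domMeasure ≤ M := by linarith
  have hqM : ∫ x, ‖q x‖ ^ 2 ∂HelmholtzSource.domMeasure ≤ M := by linarith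
  have hMM : M ≤ M ^ 2 := le_self_pow₀ hM two_ne_zero
  have hdata := (HelmholtzSource.four_mul_dataSize_sq (by linarith) hu).symm
  rw [← hε] at hdata
  have hcont := HelmholtzSource.continuous_fourierDom (hf2.integrable one_le_two)
  have hsmall : ∫ ξ in (0 : ℝ)..1, (‖HelmholtzSource.fourierDom f ξ‖ ^ 2 +
      ‖HelmholtzSource.fourierDom f (-ξ)‖ ^ 2) ≤ 4 * ε ^ 2 := by
    rw [← hdata]
    exact intervalIntegral.integral_mono_interval le_rfl zero_le_one hK.le
      (Filter.Eventually.of_forall fun _ => by positivity)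
      (Continuous.intervalIntegrable (by fun_prop) _ _)
  have hcore : ∀ n : ℕ, 1 ≤ n → 4 * ε ^ 2 ≤ 4 * Real.exp (-((n : ℝ) - 1) ^ 4) ^ 2 →
      ∫ x, ‖f x‖ ^ 2 ∂HelmholtzSource.domMeasure ≤ C₁ * M / n ^ 2 := fun n hn h =>
    HelmholtzSource.integral_sq_le_of_small hf2 hq hfq hM hfM hqM hn (hsmall.trans h)
  clear_value C₁
  have hK0 : 0 < K := by linarith
  refine ⟨fun hε0 => ?_, fun hε0 => ?_⟩
  · change ∫ x, ‖f x‖ ^ 2 ∂HelmholtzSource.domMeasure ≤ _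
    set E := HelmholtzSource.logData ε with hE
    have hE0 : 0 ≤ E := le_max_right _ _
    set Q := E ^ (1 / 4 : ℝ) with hQ
    have hQ0 : 0 ≤ Q := Real.rpow_nonneg hE0 _
    have hK23 : 0 < K ^ (2 / 3 : ℝ) := Real.rpow_pos_of_pos hK0 _
    set P := K ^ (2 / 3 : ℝ) * Q + 1 with hP
    have hP0 : 0 < P := by positivity
    have hMP : 0 ≤ M ^ 2 / P := by positivity
    have hCε : 0 ≤ C₁ * ε ^ 2 := by positivity
    have hCM : 0 ≤ C₁ * (M ^ 2 / P) := by positivity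
    have hε2 : 0 ≤ ε ^ 2 := sq_nonneg ε
    have hexpand : (2 * C₁ + 50) * (ε ^ 2 + M ^ 2 / P) =
        2 * (C₁ * ε ^ 2) + 50 * ε ^ 2 + 2 * (C₁ * (M ^ 2 / P)) + 50 * (M ^ 2 / P) := by ring
    rw [hexpand]
    -- Any bound `cM / D` with `P ≤ 2D` is admissible; `M ≥ 1` turns `M` into `M²`.
    have hfrac : ∀ c D : ℝ, 0 ≤ c → 0 < D → P ≤ 2 * D → c * M / D ≤ 2 * c * (M ^ 2 / P) := by
      intro c D hc hD hPD
      rw [← mul_div_assoc, div_le_div_iff₀ hD hP0]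
      calc c * M * P ≤ c * M ^ 2 * (2 * D) := by gcongr
        _ = _ := by ring
    -- The threshold is where `K^{2/3} Q` reaches `K²`. Data with `ε > 1` have `Q = 0` and fall in
    -- the first case.
    rcases le_total Q (K ^ (4 / 3 : ℝ)) with hcase | hcase
    · have hPK : P ≤ K ^ 2 + 1 := by
        have h1 : K ^ (2 / 3 : ℝ) * K ^ (4 / 3 : ℝ) = K ^ 2 := by
          rw [← Real.rpow_add hK0]
          norm_num
        rw [hP, ← h1]
        gcongr
      rcases le_or_gt K 4 with hK4 | hK4
      -- For `K ≤ 4` the denominator `P` is at most `17`, so the trivial bound by `M` suffices.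
      · have h1 : M ≤ 17 * (M ^ 2 / P) := by
          rw [← mul_div_assoc, le_div_iff₀ hP0]
          have h2 : K ^ 2 ≤ 4 ^ 2 := by gcongr
          calc M * P ≤ M ^ 2 * 17 := by
                gcongr
                linarith
            _ = _ := mul_comm _ _
        linarith
      · have h1 := HelmholtzSource.integral_sq_le_of_four_lt hf2 hq hfq hqM hK4 hdata
        have h2 := hfrac 25 (K ^ 2) (by norm_num) (by positivity)
          (by linarith [one_le_pow₀ (n := 2) hK.le])
        linarith
    · have hKQ : K ^ (2 / 3 : ℝ) ≤ Q :=
        (Real.rpow_le_rpow_of_exponent_le hK.le (by norm_num)).trans hcase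
      have hQ1 : 1 < Q := (Real.one_lt_rpow hK (by norm_num)).trans_le hcase
      have hQE : Q ^ 4 = E := by
        rw [hQ, ← Real.rpow_natCast, ← Real.rpow_mul hE0]
        norm_num
      have hEpos : 0 < E := by rw [← hQE]; positivity
      have hElog : E = -Real.log ε := by
        rw [hE, HelmholtzSource.logData]
        refine max_eq_left (le_of_lt ?_)
        by_contra! hc
        rw [hE, HelmholtzSource.logData, max_eq_right hc] at hEpos
        exact lt_irrefl _ hEpos
      have hεexp : ε = Real.exp (-Q ^ 4) := by
        rw [hQE, hElog, neg_neg, Real.exp_log hε0]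
      -- Rounding up gives `n - 1 < Q`, so `ε = exp(-Q^4)` meets the threshold `exp(-(n-1)^4)`,
      -- while `Q ≤ n` gives `P ≤ n² + 1 ≤ 2n²`.
      set n := ⌈Q⌉₊ with hn
      have hn1 : Q ≤ n := Nat.le_ceil Q
      have hn2 : (n : ℝ) < Q + 1 := Nat.ceil_lt_add_one hQ0
      have hn3 : 1 ≤ n := Nat.ceil_pos.2 (by linarith)
      have hn4 : (1 : ℝ) ≤ n := by exact_mod_cast hn3
      have hpow : ((n : ℝ) - 1) ^ 4 ≤ Q ^ 4 :=
        pow_le_pow_left₀ (by linarith) (by linarith) 4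
      have h1 := hcore n hn3 (by
        rw [hεexp]
        gcongr)
      have h2 := hfrac C₁ ((n : ℝ) ^ 2) hC₁0.le (by positivity) (by
        have : K ^ (2 / 3 : ℝ) * Q ≤ n * n := by
          gcongr
          exact hKQ.trans hn1
        linarith [one_le_pow₀ (n := 2) hn4, sq (n : ℝ)])
      linarith
  -- Zero data satisfy the smallness hypothesis for every `n`, so `n` may tend to infinity.
  · have hzero : ∫ x, ‖f x‖ ^ 2 ∂HelmholtzSource.domMeasure ≤ 0 := by
      have hlim : Filter.Tendsto (fun n : ℕ => C₁ * M / (n : ℝ) ^ 2) Filter.atTop (nhds 0) :=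
        tendsto_const_nhds.div_atTop
          ((Filter.tendsto_pow_atTop two_ne_zero).comp tendsto_natCast_atTop_atTop)
      refine ge_of_tendsto hlim ?_
      filter_upwards [Filter.eventually_ge_atTop 1] with n hn
      refine hcore n hn ?_
      rw [hε0, zero_pow two_ne_zero, mul_zero]
      positivity
    have h0 := le_antisymm hzero hf0
    rw [MeasureTheory.integral_eq_zero_iff_of_nonneg (fun x => by positivity)
      hf2.integrable_norm_pow'] at h0
    filter_upwards [h0] with x hx
    simpa using hx
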